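/- Let $G$ be a simple graph. Write $L(G)$ for its line graph (vertices are the edges of $G$; two distinct edges are adjacent if they share an end vertex) and $H^2$ for the square of a graph $H$ (distinct vertices are adjacent if their distance in $H$ is at most $2$). A graph is chordal if every cycle of length at least $4$ has a chord. A sprout of size $n$ is a graph $S$ whose edge set is partitioned into sets $U$, $W$, $E$ with $U=\{u_1,\dots,u_n\}$, $W=\{w_1,\dots,w_q\}$, $|U|=n$, $|W|=q$, $\lceil n/2\rceil\le q\le n$ (indices of $u$ are read modulo $n$, those of $w$ modulo $q$), such that: (i) there is a cycle $C$ in $S$ containing all edges of $W$, in the order $w_1,\dots,w_q$; (ii) $u_1,\dots,u_n$ are numbered in order of their appearance along $C$ (an edge attached at a vertex of $C$ appears at that vertex), where $u_1$ is the first one after $w_q$, and $u_i\cap u_j=\emptyset$ whenever $i\ne j$ and $j\ne i\pm1 \pmod n$; (iii) if $w_i$ and $w_{i+1}$ are consecutive on $C$, then exactly one $u\in U$ contains their common vertex at that place of $C$, and it is the edge of $U$ between $w_i$ and $w_{i+1}$; such edges $u$ are called pending; (iv) otherwise, the part of $C$ between $w_i$ and $w_{i+1}$ consists of exactly one or exactly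 two edges, all of them in $U$; (v) the pending edges are pairwise disjoint, and all edges of $U$ that are not pending are edges of $C$. The sprout is fertile if no edge of $S$ connects two non-consecutive edges $u_i,u_j$ of $U$ (that is, no edge of $S$ has one end vertex in $u_i$ and the other in $u_j$, where $i\ne j$ and $j\neq i\pm1\pmod n$). Theorem. $L(G)^2$ is chordal if and only if $G$ contains no induced cycle of length $l\ge 6$ and no induced subgraph that is a fertile sprout of size $4$ or $5$. -/

import Mathlib

namespace ChordalLineSquare

variable {V : Type*}

/-- A graph is chordal if every cycle of length at least `4` has a chord, that is, an edge of the
graph which joins two vertices of the cycle and is not an edge of the cycle. -/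
def IsChordal (G : SimpleGraph V) : Prop :=
  ∀ (v : V) (C : G.Walk v v), C.IsCycle → 4 ≤ C.length →
    ∃ x ∈ C.support, ∃ y ∈ C.support, G.Adj x y ∧ s(x, y) ∉ C.edges

/-- The `k`-th power of `G`: `x` and `y` are adjacent if and only if `1 ≤ dist x y ≤ k`. The
distance is `ℕ∞`-valued, with value `⊤` between different components. -/
def power (G : SimpleGraph V) (k : ℕ) : SimpleGraph V where
  Adj x y := 1 ≤ G.edist x y ∧ G.edist x y ≤ k
  symm := ⟨fun x y h => by rwa [SimpleGraph.edist_comm] at h⟩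
  loopless := ⟨fun x h => by simp at h⟩

/-- Two edges meet if they have a common end vertex. -/
def Meet (e f : Sym2 V) : Prop := ∃ x, x ∈ e ∧ x ∈ f

/-- Three edges meet in a common vertex. -/
def Meet₃ (e f g : Sym2 V) : Prop := ∃ x, x ∈ e ∧ x ∈ f ∧ x ∈ g

/-- `i` and `j` are different, and `j ≠ i ± 1` modulo `n`. -/
def NonConsecutive {n : ℕ} (i j : Fin n) : Prop :=
  i ≠ j ∧ j ≠ finRotate n i ∧ i ≠ finRotate n j

/-- The data that make a graph `S` a sprout of size `n`: edges `u 0, …, u (n-1)` (the set `U`),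
edges `w 0, …, w (q-1)` (the set `W`) and a cycle `C`. The set `E` consists of the remaining edges
of `S`. Indices of `u` are read modulo `n`, those of `w` modulo `q`. -/
structure Sprout (S : SimpleGraph V) (n : ℕ) where
  /-- The number of `w`-edges, with `⌈n / 2⌉ ≤ q ≤ n`. -/
  q : ℕ
  le_q : (n + 1) / 2 ≤ q
  q_le : q ≤ n
  u : Fin n → Sym2 V
  w : Fin q → Sym2 V
  u_mem : ∀ i, u i ∈ S.edgeSet
  w_mem : ∀ i, w i ∈ S.edgeSet
  u_injective : Function.Injective u
  w_injective : Function.Injective w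
  u_ne_w : ∀ i j, u i ≠ w j
  /-- The cycle `C`. It is traversed starting at the end vertex of the last `w`-edge. -/
  base : V
  C : S.Walk base base
  isCycle : C.IsCycle
  /-- `gap i` lists the edges of `C` strictly between `w (i-1)` and `w i`; in particular
  `w (i-1)` and `w i` share their vertex on that stretch of `C` if and only if `gap i` is empty. -/
  gap : Fin q → List (Sym2 V)
  /-- `C` contains all `w`-edges, in the order `w 0, …, w (q-1)`. -/
  edges_eq : C.edges = (List.ofFn fun i => gap i ++ [w i]).flatten
  /-- `petals i` lists the `u`-edges that appear between `w (i-1)` and `w i` along `C`, including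
  one attached at their common vertex. -/
  petals : Fin q → List (Sym2 V)
  /-- The `u`-edges are sorted by their appearance along `C`, and `u 0` is the first of them after
  the last `w`-edge. -/
  u_eq : List.ofFn u = (List.ofFn petals).flatten
  /-- Non-consecutive `u`-edges are disjoint. -/
  u_disjoint : ∀ i j, NonConsecutive i j → ¬ Meet (u i) (u j)
  /-- If `w (i-1)` and `w i` share a vertex (as neighbours on `C`), then exactly one `u`-edge
  contains that vertex, and this is the `u`-edge between them; such `u`-edges are called pending. -/
  pending : ∀ i, gap i = [] → ∃ p, petals i = [p] ∧
    Meet₃ (w ((finRotate q).symm i)) (w i) p ∧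
    ∀ k, Meet₃ (w ((finRotate q).symm i)) (w i) (u k) → u k = p
  /-- Otherwise the stretch of `C` between `w (i-1)` and `w i` consists of one or two `u`-edges. -/
  connecting : ∀ i, gap i ≠ [] →
    petals i = gap i ∧ ((gap i).length = 1 ∨ (gap i).length = 2)
  /-- Pending edges are pairwise non-adjacent. (All other `u`-edges are edges of `C`, by
  `connecting`.) -/
  pending_disjoint : ∀ i j, i ≠ j → gap i = [] → gap j = [] →
    ∀ p ∈ petals i, ∀ p' ∈ petals j, ¬ Meet p p'

/-- A sprout is fertile if no edge of the graph `S` connects two non-consecutive `u`-edges, i.e. has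
one end vertex in each of them. -/
def Sprout.IsFertile {S : SimpleGraph V} {n : ℕ} (P : Sprout S n) : Prop :=
  ∀ i j, NonConsecutive i j → ∀ x ∈ P.u i, ∀ y ∈ P.u j, ¬ S.Adj x y

/-- `G` contains a fertile sprout of size `n` (as an induced subgraph). -/
def ContainsFertileSprout (G : SimpleGraph V) (n : ℕ) : Prop :=
  ∃ X : Set V, ∃ P : Sprout (G.induce X) n, P.IsFertile

end ChordalLineSquare

/-!
Two edges of `G` are *near* if they meet or are joined by an edge. Adjacency in `L(G)²` is nearness
of distinct edges, so `L(G)²` fails to be chordal exactly if `G` has an *edge hole*: a cyclic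
sequence `u 0, …, u (n-1)` of `n ≥ 4` edges in which consecutive edges are near and all others are
not (`isChordal_power_lineGraph_iff`). It remains to compare edge holes with long induced cycles and
fertile sprouts.

Every other edge of an induced cycle of length `l ≥ 7` gives an edge hole; in an induced `6`-cycle
it consists of two opposite pairs of adjacent edges (`exists_isEdgeHole_of_cycleGraph`). In a fertile sprout the
`u`-edges form an edge hole: fertility and disjointness separate the non-consecutive ones, and
consecutive ones either follow each other on the cycle or both meet the `w`-edge between them
(`Sprout.isEdgeHole`).

Conversely, let `u` be an edge hole. Choose an entry vertex `x i` and an exit vertex `y i` of each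
`u i`, where `y i` is equal or adjacent to `x (i + 1)` (`Transversal`). Since `u (i - 1)` and
`u (i + 1)` are not near, `x i ∉ u (i + 1)` and `y i ∉ u (i - 1)`. Hence the closed walk
`x 0, y 0, x 1, y 1, …` without its repetitions is a cycle, of length at least `n`
(`Transversal.exists_cycle`).

* If the transversal uses a common vertex of `u i` and `u (i + 1)` whenever there is one, then the
  cycle makes `u` a fertile sprout of size `n` (`IsEdgeHole.exists_fertile_sprout`). Its `w`-edges
  are the steps `y i`, `x (i + 1)` between disjoint edges. No two consecutive pairs of `u`-edges
  meet, which bounds the gaps between the `w`-edges. This settles `n = 4` and `n = 5`.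
* If the transversal is shortest possible, then the cycle has no chord: a chord could only join
  consecutive edges of the hole, and would be a shortcut (`Transversal.mem_edges_of_minimal`). So
  `G` has an induced cycle of length at least `n` (`IsEdgeHole.exists_cycleGraph`), which settles
  `n ≥ 6`.
-/

namespace ChordalLineSquare
open SimpleGraph

variable {V : Type*}

/-! ### Chordality and induced cycles -/

theorem val_add_one {n : ℕ} [NeZero n] (hn : 2 ≤ n) (i : Fin n) :
    (i + 1).val = if i.val + 1 = n then 0 else i.val + 1 := by
  have h1 : (1 : Fin n).val = 1 := by
    rw [Fin.val_one', Nat.mod_eq_of_lt (by omega)]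
  rw [Fin.val_add, h1]
  split_ifs with h
  · rw [h, Nat.mod_self]
  · exact Nat.mod_eq_of_lt (by omega)

theorem cycleGraph_adj_iff {n : ℕ} [NeZero n] (hn : 2 ≤ n) (i j : Fin n) :
    (cycleGraph n).Adj i j ↔ j = i + 1 ∨ i = j + 1 := by
  obtain ⟨m, rfl⟩ : ∃ m, n = m + 2 := ⟨n - 2, by omega⟩
  rw [cycleGraph_adj, sub_eq_iff_eq_add', sub_eq_iff_eq_add', or_comm]

/-- The vertices of a chordless cycle induce a cycle graph. -/
theorem cycleGraph_isIndContained {G : SimpleGraph V} {v : V} {C : G.Walk v v} (hC : C.IsCycle)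
    (h : ∀ x ∈ C.support, ∀ y ∈ C.support, G.Adj x y → s(x, y) ∈ C.edges) :
    (cycleGraph C.length).IsIndContained G := by
  have h3 := hC.three_le_length
  have : NeZero C.length := ⟨by omega⟩
  have hinj : ∀ {i j : ℕ}, i < C.length → j < C.length → C.getVert i = C.getVert j → i = j :=
    fun hi hj hij => hC.getVert_injOn' (Nat.le_sub_one_of_lt hi) (Nat.le_sub_one_of_lt hj) hij
  have hsucc : ∀ i : Fin C.length, C.getVert (i + 1).val = C.getVert (i.val + 1) := by
    intro i
    rw [val_add_one (by omega)]
    split_ifs with hi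
    · rw [hi, Walk.getVert_length, Walk.getVert_zero]
    · rfl
  have hinj' : Function.Injective fun i : Fin C.length => C.getVert i.val :=
    fun i j hij => Fin.ext (hinj i.2 j.2 hij)
  refine ⟨⟨⟨_, hinj'⟩, ?_⟩⟩
  intro i j
  rw [cycleGraph_adj_iff (by omega)]
  simp only [Function.Embedding.coeFn_mk]
  constructor
  · intro hadj
    have hmem := h _ (C.getVert_mem_support i) _ (C.getVert_mem_support j) hadj
    obtain ⟨k, hkl, hk⟩ := (Walk.mk_mem_edges_iff_exists C).1 hmem
    have hk' := hsucc ⟨k, by omega⟩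
    simp only at hk'
    rw [← hk'] at hk
    have hkf : C.getVert k = C.getVert (⟨k, by omega⟩ : Fin C.length).val := rfl
    rw [hkf] at hk
    rcases Sym2.eq_iff.1 hk.symm with ⟨h1, h2⟩ | ⟨h1, h2⟩
    · left
      rw [← Fin.ext (hinj i.2 (Fin.is_lt _) h1)] at h2
      exact Fin.ext (hinj (Fin.is_lt _) (Fin.is_lt _) h2)
    · right
      rw [← Fin.ext (hinj j.2 (Fin.is_lt _) h2)] at h1
      exact Fin.ext (hinj (Fin.is_lt _) (Fin.is_lt _) h1)
  · have key : ∀ i : Fin C.length, G.Adj (C.getVert i) (C.getVert (i + 1).val) := fun i => by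
      rw [hsucc]
      exact C.adj_getVert_succ i.2
    rintro (rfl | rfl)
    · exact key i
    · exact (key j).symm

theorem isChordal_iff {G : SimpleGraph V} :
    IsChordal G ↔ ∀ n : ℕ, 4 ≤ n → ¬ (cycleGraph n).IsIndContained G := by
  constructor
  · rintro h n hn ⟨f⟩
    obtain ⟨m, rfl⟩ : ∃ m, n = m + 3 := ⟨n - 3, by omega⟩
    have hC : ((cycleGraph.cycle m).map f.toHom).IsCycle :=
      (Walk.isCycle_map_iff_of_injective f.injective).mpr cycleGraph.isCycle_cycle
    obtain ⟨x, hx, y, hy, hadj, hxy⟩ := h _ _ hC (by simpa using hn)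
    rw [Walk.support_map, List.mem_map] at hx hy
    obtain ⟨a, -, rfl⟩ := hx
    obtain ⟨b, -, rfl⟩ := hy
    have key : ∀ i : Fin (m + 3), s(i, i + 1) ∈ (cycleGraph.cycle m).edges := by
      intro i
      rw [Walk.mk_mem_edges_iff_exists]
      refine ⟨m + 2 - i.val, by rw [cycleGraph.length_cycle]; omega, ?_⟩
      have hi := i.2
      have h1 := val_add_one (by omega) i
      rw [cycleGraph.getVert_cycle (by omega), cycleGraph.getVert_cycle (by omega), Sym2.eq_swap]
      refine congrArg₂ (fun a b => s(a, b)) (Fin.ext ?_) (Fin.ext ?_)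
      · simp only
        rw [show m + 3 - (m + 2 - i.val + 1) = i.val by omega, Nat.mod_eq_of_lt hi]
      · simp only
        rw [show m + 3 - (m + 2 - i.val) = i.val + 1 by omega, h1]
        split_ifs with h2
        · rw [h2, Nat.mod_self]
        · exact Nat.mod_eq_of_lt (by omega)
    have key' : s(a, b) ∈ (cycleGraph.cycle m).edges := by
      rcases (cycleGraph_adj_iff (by omega) a b).1 (f.map_adj_iff.1 hadj) with rfl | rfl
      · exact key a
      · rw [Sym2.eq_swap]
        exact key b
    apply hxy
    rw [Walk.edges_map]
    exact List.mem_map.2 ⟨s(a, b), key', rfl⟩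
  · intro h v C hC hl
    by_contra hcon
    refine h _ hl (cycleGraph_isIndContained hC fun x hx y hy hadj => ?_)
    by_contra hxy
    exact hcon ⟨x, hx, y, hy, hadj, hxy⟩

/-! ### Edge holes -/

/-- Two edges are near if they meet or are joined by an edge of `G`, that is, if their distance in
the line graph of `G` is at most `2`. -/
def Near (G : SimpleGraph V) (e f : Sym2 V) : Prop := ∃ a ∈ e, ∃ b ∈ f, a = b ∨ G.Adj a b

theorem Near.symm {G : SimpleGraph V} {e f : Sym2 V} (h : Near G e f) : Near G f e := by
  obtain ⟨a, ha, b, hb, hab⟩ := h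
  exact ⟨b, hb, a, ha, hab.imp Eq.symm fun h => h.symm⟩

theorem power_lineGraph_adj {G : SimpleGraph V} (e f : G.edgeSet) :
    (power G.lineGraph 2).Adj e f ↔ e ≠ f ∧ Near G e f := by
  have hpow : (power G.lineGraph 2).Adj e f ↔ e ≠ f ∧
      (G.lineGraph.Adj e f ∨ ∃ g, G.lineGraph.Adj e g ∧ G.lineGraph.Adj g f) := by
    change 1 ≤ _ ∧ _ ≤ ((2 : ℕ) : ℕ∞) ↔ _
    constructor
    · rintro ⟨h1, h2⟩
      refine ⟨fun h => by simp [h] at h1, ?_⟩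
      obtain ⟨p, hp⟩ := exists_walk_of_edist_ne_top (ne_top_of_le_ne_top (by simp) h2)
      rw [← hp] at h1 h2
      norm_cast at h1 h2
      match p with
      | .nil => simp at h1
      | .cons h .nil => exact Or.inl h
      | .cons h (.cons h' .nil) => exact Or.inr ⟨_, h, h'⟩
      | .cons h (.cons h' (.cons h'' q)) => simp at h2
    · rintro ⟨hne, h⟩
      refine ⟨Order.one_le_iff_pos.2 (edist_pos_of_ne hne), ?_⟩
      rcases h with h | ⟨g, h, h'⟩
      · exact (edist_le h.toWalk).trans (by simp)
      · exact (edist_le (Walk.cons h h'.toWalk)).trans (by simp)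
  rw [hpow]
  refine and_congr_right fun hne => ⟨?_, ?_⟩
  · rintro (h | ⟨g, h, h'⟩)
    · obtain ⟨-, x, hx, hx'⟩ := lineGraph_adj_iff_exists.1 h
      exact ⟨x, hx, x, hx', Or.inl rfl⟩
    · obtain ⟨-, x, hx, hx'⟩ := lineGraph_adj_iff_exists.1 h
      obtain ⟨-, y, hy, hy'⟩ := lineGraph_adj_iff_exists.1 h'
      refine ⟨x, hx, y, hy', or_iff_not_imp_left.2 fun hxy => ?_⟩
      rw [← mem_edgeSet, ← (Sym2.mem_and_mem_iff hxy).1 ⟨hx', hy⟩]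
      exact g.2
  · rintro ⟨x, hx, y, hy, hxy⟩
    by_cases hm : ∃ z, z ∈ (e : Sym2 V) ∧ z ∈ (f : Sym2 V)
    · exact Or.inl (lineGraph_adj_iff_exists.2 ⟨hne, hm⟩)
    · have hadj : G.Adj x y := hxy.resolve_left fun h => hm ⟨x, hx, h ▸ hy⟩
      refine Or.inr ⟨⟨s(x, y), hadj⟩, lineGraph_adj_iff_exists.2 ⟨?_, x, hx, by simp⟩,
        lineGraph_adj_iff_exists.2 ⟨?_, y, by simp, hy⟩⟩
      · rintro rfl
        exact hm ⟨y, by simp, hy⟩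
      · rintro rfl
        exact hm ⟨x, hx, by simp⟩

/-- A cyclic sequence of at least four edges of `G` in which consecutive edges are near and
non-consecutive ones are not. -/
structure IsEdgeHole (G : SimpleGraph V) {n : ℕ} [NeZero n] (u : Fin n → Sym2 V) : Prop where
  four_le : 4 ≤ n
  mem : ∀ i, u i ∈ G.edgeSet
  near : ∀ i, Near G (u i) (u (i + 1))
  far : ∀ i j, j ≠ i → j ≠ i + 1 → i ≠ j + 1 → ¬ Near G (u i) (u j)

theorem add_one_ne {n : ℕ} [NeZero n] (hn : 4 ≤ n) (i : Fin n) :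
    i + 1 ≠ i ∧ i + 1 + 1 ≠ i ∧ i + 1 + 1 + 1 ≠ i := by
  have h1 := val_add_one (by omega) i
  have h2 := val_add_one (by omega) (i + 1)
  have h3 := val_add_one (by omega) (i + 1 + 1)
  simp only [Ne, Fin.ext_iff]
  grind

namespace IsEdgeHole

variable {G : SimpleGraph V} {n : ℕ} [NeZero n] {u : Fin n → Sym2 V}

theorem adj (hu : IsEdgeHole G u) {i : Fin n} {p q : V} (hp : p ∈ u i) (hq : q ∈ u i)
    (h : p ≠ q) : G.Adj p q := by
  rw [← mem_edgeSet, ← (Sym2.mem_and_mem_iff h).1 ⟨hp, hq⟩]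
  exact hu.mem i

theorem eq_or_consecutive_of_near (hu : IsEdgeHole G u) {i j : Fin n} (h : Near G (u i) (u j)) :
    j = i ∨ j = i + 1 ∨ i = j + 1 := by
  by_contra hcon
  simp only [not_or] at hcon
  exact hu.far i j hcon.1 hcon.2.1 hcon.2.2 h

theorem far_add_two (hu : IsEdgeHole G u) (i : Fin n) : ¬ Near G (u i) (u (i + 1 + 1)) := by
  have := add_one_ne hu.four_le i
  have h1 := add_one_ne hu.four_le (i + 1)
  exact hu.far _ _ this.2.1 h1.1 this.2.2.symm

theorem injective (hu : IsEdgeHole G u) : Function.Injective u := by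
  have key : ∀ i, u i ≠ u (i + 1) := fun i h => hu.far_add_two i (h ▸ hu.near (i + 1))
  intro i j hij
  by_contra hne
  by_cases h1 : j = i + 1
  · exact key i (h1 ▸ hij)
  by_cases h2 : i = j + 1
  · exact key j (h2 ▸ hij.symm)
  obtain ⟨x, hx⟩ : ∃ x, x ∈ u i := ⟨_, (u i).out_fst_mem⟩
  exact hu.far i j (Ne.symm hne) h1 h2 ⟨x, hx, x, hij ▸ hx, Or.inl rfl⟩

end IsEdgeHole

theorem cycleGraph_isIndContained_power_lineGraph_iff {G : SimpleGraph V} {n : ℕ} [NeZero n]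
    (hn : 4 ≤ n) : (cycleGraph n).IsIndContained (power G.lineGraph 2) ↔
      ∃ u : Fin n → Sym2 V, IsEdgeHole G u := by
  constructor
  · rintro ⟨f⟩
    have hadj : ∀ i j, (j = i + 1 ∨ i = j + 1) ↔ f i ≠ f j ∧ Near G (f i : Sym2 V) (f j) := by
      intro i j
      rw [← power_lineGraph_adj, f.map_adj_iff, cycleGraph_adj_iff (by omega)]
    refine ⟨fun i => f i, hn, fun i => (f i).2, fun i => ((hadj _ _).1 (Or.inl rfl)).2, ?_⟩
    intro i j h h1 h2 hnear
    rcases (hadj i j).2 ⟨fun h' => h (f.injective h').symm, hnear⟩ with h' | h'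
    exacts [h1 h', h2 h']
  · rintro ⟨u, hu⟩
    have hinj : Function.Injective fun i => (⟨u i, hu.mem i⟩ : G.edgeSet) :=
      fun i j h => hu.injective (congrArg Subtype.val h)
    refine ⟨⟨⟨_, hinj⟩, ?_⟩⟩
    intro i j
    simp only [Function.Embedding.coeFn_mk]
    rw [power_lineGraph_adj, cycleGraph_adj_iff (by omega), hinj.ne_iff]
    constructor
    · rintro ⟨hne, h⟩
      by_contra hcon
      rw [not_or] at hcon
      exact hu.far i j (Ne.symm hne) hcon.1 hcon.2 h
    · rintro (rfl | rfl)
      · exact ⟨(add_one_ne hn i).1.symm, hu.near i⟩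
      · exact ⟨(add_one_ne hn j).1, (hu.near j).symm⟩

theorem isChordal_power_lineGraph_iff {G : SimpleGraph V} :
    IsChordal (power G.lineGraph 2) ↔
      ∀ (n : ℕ) [NeZero n] (u : Fin n → Sym2 V), ¬ IsEdgeHole G u := by
  rw [isChordal_iff]
  constructor
  · intro h n _ u hu
    exact h n hu.four_le ((cycleGraph_isIndContained_power_lineGraph_iff hu.four_le).2 ⟨u, hu⟩)
  · intro h n hn hc
    have : NeZero n := ⟨by omega⟩
    obtain ⟨u, hu⟩ := (cycleGraph_isIndContained_power_lineGraph_iff hn).1 hc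
    exact h n u hu

/-! ### Long induced cycles yield edge holes -/

/-- Edges of an induced cycle are near if and only if at most two steps apart. -/
theorem near_cycle_iff {G : SimpleGraph V} {l : ℕ} [NeZero l] (hl : 4 ≤ l) (f : cycleGraph l ↪g G)
    (a b : Fin l) : Near G s(f a, f (a + 1)) s(f b, f (b + 1)) ↔
      b = a ∨ b = a + 1 ∨ b = a + 1 + 1 ∨ a = b + 1 ∨ a = b + 1 + 1 := by
  have key : ∀ p q, (f p = f q ∨ G.Adj (f p) (f q)) ↔ p = q ∨ q = p + 1 ∨ p = q + 1 := fun p q => by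
    rw [f.injective.eq_iff, f.map_adj_iff, cycleGraph_adj_iff (by omega)]
  simp only [Near, Sym2.mem_iff, or_and_right, exists_or, exists_eq_left, key, add_left_inj]
  grind

theorem exists_isEdgeHole_of_cycleGraph {G : SimpleGraph V} {l : ℕ} (hl : 6 ≤ l)
    (h : (cycleGraph l).IsIndContained G) :
    ∃ (n : ℕ) (_ : NeZero n) (u : Fin n → Sym2 V), IsEdgeHole G u := by
  obtain ⟨f⟩ := h
  rcases hl.eq_or_lt with rfl | hl
  · let g : Fin 4 → Fin 6 := ![0, 1, 3, 4]
    refine ⟨4, inferInstance, fun i => s(f (g i), f (g i + 1)), le_rfl,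
      fun i => f.map_adj_iff.2 ((cycleGraph_adj_iff (by omega) _ _).2 (Or.inl rfl)), ?_, ?_⟩
    · intro i
      rw [near_cycle_iff (by omega)]
      revert i
      decide
    · intro i j
      rw [near_cycle_iff (by omega)]
      revert i j
      decide
  · -- For `l ≥ 7` every other edge of the cycle is taken, starting and, if `l` is odd, ending with
    -- an edge at vertex `0`.
    have : NeZero l := ⟨by omega⟩
    have : NeZero ((l + 1) / 2) := ⟨by omega⟩
    let g : Fin ((l + 1) / 2) → Fin l := fun i => ⟨2 * i.val, by have := i.2; omega⟩
    have hg : ∀ i, (g i).val = 2 * i.val := fun i => rfl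
    refine ⟨(l + 1) / 2, inferInstance, fun i => s(f (g i), f (g i + 1)), by omega,
      fun i => f.map_adj_iff.2 ((cycleGraph_adj_iff (by omega) _ _).2 (Or.inl rfl)), ?_, ?_⟩
    · intro i
      rw [near_cycle_iff (by omega)]
      simp only [Fin.ext_iff, val_add_one (show 2 ≤ l by omega), hg,
        val_add_one (show 2 ≤ (l + 1) / 2 by omega)]
      have := i.2
      split_ifs <;> omega
    · intro i j
      rw [near_cycle_iff (by omega)]
      simp only [Ne, Fin.ext_iff, val_add_one (show 2 ≤ l by omega), hg,
        val_add_one (show 2 ≤ (l + 1) / 2 by omega)]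
      have := i.2
      have := j.2
      split_ifs <;> omega

/-! ### Fertile sprouts yield edge holes -/

theorem Meet.symm {e f : Sym2 V} (h : Meet e f) : Meet f e := by
  obtain ⟨x, hx, hx'⟩ := h
  exact ⟨x, hx', hx⟩

theorem Meet.near {e f : Sym2 V} (h : Meet e f) (G : SimpleGraph V) : Near G e f := by
  obtain ⟨x, hx, hx'⟩ := h
  exact ⟨x, hx, x, hx', Or.inl rfl⟩

theorem near_of_meet {G : SimpleGraph V} {e f g : Sym2 V} (hg : g ∈ G.edgeSet) (h : Meet e g)
    (h' : Meet g f) : Near G e f := by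
  obtain ⟨x, hx, hx'⟩ := h
  obtain ⟨y, hy, hy'⟩ := h'
  refine ⟨x, hx, y, hy', or_iff_not_imp_left.2 fun hxy => ?_⟩
  rw [← mem_edgeSet, ← (Sym2.mem_and_mem_iff hxy).1 ⟨hx', hy⟩]
  exact hg

theorem isChain_meet_edges {G : SimpleGraph V} {x y : V} (p : G.Walk x y) :
    p.edges.IsChain Meet := by
  rw [Walk.edges_eq_map_darts, List.isChain_map]
  refine p.isChain_dartAdj_darts.imp fun d d' h => ?_
  exact ⟨d.snd, Sym2.mem_mk_right _ _, h ▸ Sym2.mem_mk_left _ _⟩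

theorem head?_flatten_ofFn {α : Type*} {q : ℕ} [NeZero q] (F : Fin q → List α) (h : F 0 ≠ []) :
    (List.ofFn F).flatten.head? = (F 0).head? := by
  obtain ⟨m, rfl⟩ : ∃ m, q = m + 1 := ⟨q - 1, by have := NeZero.ne q; omega⟩
  rw [List.ofFn_succ, List.flatten_cons, List.head?_append_of_ne_nil _ h]

theorem getLast?_flatten_ofFn {α : Type*} {q : ℕ} (F : Fin q → List α) (i : Fin q)
    (hi : i.val + 1 = q) (h : F i ≠ []) :
    (List.ofFn F).flatten.getLast? = (F i).getLast? := by
  obtain ⟨m, rfl⟩ : ∃ m, q = m + 1 := ⟨q - 1, by omega⟩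
  obtain rfl : i = Fin.last m := Fin.ext (by simp; omega)
  rw [List.ofFn_succ_last, List.flatten_append, List.flatten_singleton,
    List.getLast?_append_of_ne_nil _ h]

theorem add_one_eq_zero_of_val {n : ℕ} [NeZero n] (i : Fin n) (hi : i.val + 1 = n) :
    i + 1 = 0 := by
  obtain ⟨m, rfl⟩ : ∃ m, n = m + 1 := ⟨n - 1, by omega⟩
  obtain rfl : i = Fin.last m := Fin.ext (by simp; omega)
  simp

/-- The last and the first edge of a closed walk meet in its base vertex. -/
theorem meet_of_mem_edges_ends {G : SimpleGraph V} {x : V} (p : G.Walk x x) {e f : Sym2 V}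
    (he : e ∈ p.edges.getLast?) (hf : f ∈ p.edges.head?) : Meet e f := by
  have hne : p.edges ≠ [] := by
    rintro h
    simp [h] at he
  rw [List.getLast?_eq_some_getLast hne, Option.mem_some_iff] at he
  rw [List.head?_eq_some_head hne, Option.mem_some_iff] at hf
  rw [← he, ← hf, Walk.head_edges_eq_mk_start_snd, Walk.getLast_edges_eq_mk_penultimate_end]
  exact ⟨x, Sym2.mem_mk_right _ _, Sym2.mem_mk_left _ _⟩

namespace Sprout

variable {S : SimpleGraph V} {n : ℕ} (P : Sprout S n)

theorem isChain_block (i : Fin P.q) : (P.gap i ++ [P.w i]).IsChain Meet := by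
  have h := isChain_meet_edges P.C
  rw [P.edges_eq, List.isChain_flatten (by simp [List.mem_ofFn])] at h
  exact h.1 _ (List.mem_ofFn.2 ⟨i, rfl⟩)

theorem petals_ne_nil (i : Fin P.q) : P.petals i ≠ [] := by
  by_cases h : P.gap i = []
  · obtain ⟨p, hp, -⟩ := P.pending i h
    simp [hp]
  · rw [(P.connecting i h).1]
    exact h

theorem isChain_petals (i : Fin P.q) : (P.petals i).IsChain Meet := by
  by_cases h : P.gap i = []
  · obtain ⟨p, hp, -⟩ := P.pending i h
    simp [hp]
  · rw [(P.connecting i h).1]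
    exact (P.isChain_block i).left_of_append

theorem meet_of_mem_getLast? (i : Fin P.q) {p : Sym2 V} (hp : p ∈ (P.petals i).getLast?) :
    Meet p (P.w i) := by
  by_cases h : P.gap i = []
  · obtain ⟨p', hp', ⟨x, -, hx, hx'⟩, -⟩ := P.pending i h
    obtain rfl : p' = p := by simpa [hp'] using hp
    exact ⟨x, hx', hx⟩
  · rw [(P.connecting i h).1] at hp
    exact (List.isChain_append.1 (P.isChain_block i)).2.2 p hp _ (by simp)

theorem meet_of_mem_head? [NeZero P.q] (j : Fin P.q) {p : Sym2 V}
    (hp : p ∈ (P.petals (j + 1)).head?) : Meet (P.w j) p := by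
  by_cases h : P.gap (j + 1) = []
  · obtain ⟨p', hp', ⟨x, hx, -, hx'⟩, -⟩ := P.pending _ h
    obtain rfl : p' = p := by simpa [hp'] using hp
    rw [finRotate_symm_apply, add_sub_cancel_right] at hx
    exact ⟨x, hx, hx'⟩
  · rw [(P.connecting _ h).1] at hp
    have hhead : p ∈ (P.gap (j + 1) ++ [P.w (j + 1)]).head? := by
      rwa [List.head?_append_of_ne_nil _ h]
    have hlast : P.w j ∈ (P.gap j ++ [P.w j]).getLast? := by simp
    rcases (Nat.succ_le_of_lt j.2).lt_or_eq with hj | hj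
    · have hc := isChain_meet_edges P.C
      rw [P.edges_eq, List.isChain_flatten (by simp [List.mem_ofFn])] at hc
      have hc' := (List.isChain_iff_getElem.1 hc.2) j.val (by simpa using hj)
      rw [List.getElem_ofFn, List.getElem_ofFn] at hc'
      refine hc' _ hlast _ ?_
      convert hhead <;> rw [val_add_one (by omega), if_neg (by omega)]
    · rw [add_one_eq_zero_of_val j hj] at hhead
      refine meet_of_mem_edges_ends P.C ?_ ?_
      · rwa [P.edges_eq, getLast?_flatten_ofFn _ j hj (by simp)]
      · rwa [P.edges_eq, head?_flatten_ofFn _ (by simp)]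

theorem isEdgeHole (hP : P.IsFertile) [NeZero n] (hn : 4 ≤ n) : IsEdgeHole S P.u := by
  have hq := P.le_q
  have : NeZero P.q := ⟨by omega⟩
  have hchain : (List.ofFn P.u).IsChain (Near S) := by
    rw [P.u_eq, List.isChain_flatten]
    · constructor
      · intro l hl
        obtain ⟨i, rfl⟩ := List.mem_ofFn.1 hl
        exact (P.isChain_petals i).imp fun _ _ h => h.near S
      · rw [List.isChain_iff_getElem]
        intro k hk x hx y hy
        rw [List.length_ofFn] at hk
        rw [List.getElem_ofFn] at hx hy
        refine near_of_meet (P.w_mem _) (P.meet_of_mem_getLast? _ hx) (P.meet_of_mem_head? _ ?_)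
        convert hy
        rw [val_add_one (by omega), if_neg (by simp; omega)]
    · intro h
      obtain ⟨i, hi⟩ := List.mem_ofFn.1 h
      exact P.petals_ne_nil i hi
  refine ⟨hn, P.u_mem, ?_, ?_⟩
  · intro i
    by_cases hi : i.val + 1 < n
    · have h := (List.isChain_iff_getElem.1 hchain) i.val (by simpa using hi)
      rw [List.getElem_ofFn, List.getElem_ofFn] at h
      convert h
      rw [val_add_one (by omega), if_neg (by omega)]
    · have hi : i.val + 1 = n := by omega
      have hsing : (List.ofFn fun i => [P.u i]).flatten = List.ofFn P.u := by
        rw [List.ofFn_eq_map, List.ofFn_eq_map, ← List.flatMap_def, List.map_eq_flatMap]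
      have hlast : (List.ofFn P.u).getLast? = some (P.u i) := by
        have := getLast?_flatten_ofFn (fun i => [P.u i]) i hi (by simp)
        simpa [hsing] using this
      have hhead : (List.ofFn P.u).head? = some (P.u 0) := by
        have := head?_flatten_ofFn (fun i => [P.u i]) (by simp)
        simpa [hsing] using this
      let j : Fin P.q := ⟨P.q - 1, by omega⟩
      have hj : j.val + 1 = P.q := by simp only [j]; omega
      rw [P.u_eq, getLast?_flatten_ofFn _ j hj (P.petals_ne_nil _)] at hlast
      rw [P.u_eq, head?_flatten_ofFn _ (P.petals_ne_nil _), ← add_one_eq_zero_of_val j hj] at hhead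
      rw [add_one_eq_zero_of_val i hi]
      exact near_of_meet (P.w_mem j) (P.meet_of_mem_getLast? j hlast) (P.meet_of_mem_head? j hhead)
  · rintro i j h h1 h2 ⟨x, hx, y, hy, hxy⟩
    have hnc : NonConsecutive i j := ⟨h.symm, by rwa [finRotate_apply], by rwa [finRotate_apply]⟩
    rcases hxy with rfl | hxy
    · exact P.u_disjoint i j hnc ⟨x, hx, hy⟩
    · exact hP i j hnc x hx y hy hxy

end Sprout

theorem IsEdgeHole.map {W : Type*} {S : SimpleGraph W} {G : SimpleGraph V} (f : S ↪g G) {n : ℕ}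
    [NeZero n] {u : Fin n → Sym2 W} (hu : IsEdgeHole S u) :
    IsEdgeHole G fun i => (u i).map f := by
  have key : ∀ i j, Near G ((u i).map f) ((u j).map f) ↔ Near S (u i) (u j) := by
    intro i j
    simp [Near, Sym2.mem_map, f.injective.eq_iff]
  refine ⟨hu.four_le, ?_, fun i => (key _ _).2 (hu.near i),
    fun i j h h1 h2 h' => hu.far i j h h1 h2 ((key _ _).1 h')⟩
  intro i
  have := hu.mem i
  revert this
  induction u i using Sym2.ind with
  | _ x y => simp

theorem exists_isEdgeHole_of_fertileSprout {G : SimpleGraph V} {n : ℕ} (hn : 4 ≤ n)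
    (h : ContainsFertileSprout G n) :
    ∃ (_ : NeZero n) (u : Fin n → Sym2 V), IsEdgeHole G u := by
  obtain ⟨X, P, hP⟩ := h
  have : NeZero n := ⟨by omega⟩
  exact ⟨this, _, (P.isEdgeHole hP hn).map (Embedding.induce X)⟩

/-! ### Walks given by sequences of steps -/

open Classical in
/-- The edges of the walk of length at most one from `a` to an equal or adjacent vertex `b`. -/
noncomputable def stepEdges (a b : V) : List (Sym2 V) := if a = b then [] else [s(a, b)]

open Classical in
/-- The vertices, except the last one, of the walk of length at most one from `a` to `b`. -/
noncomputable def stepStart (a b : V) : List V := if a = b then [] else [a]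

theorem stepEdges_of_eq {a b : V} (h : a = b) : stepEdges a b = [] := if_pos h

theorem stepEdges_of_ne {a b : V} (h : a ≠ b) : stepEdges a b = [s(a, b)] := if_neg h

theorem mem_stepEdges {a b : V} (h : a ≠ b) : s(a, b) ∈ stepEdges a b := by
  simp [stepEdges_of_ne h]

theorem mem_stepStart {a b v : V} : v ∈ stepStart a b ↔ a ≠ b ∧ v = a := by
  unfold stepStart
  split_ifs with h <;> simp [h]

theorem nodup_stepStart (a b : V) : (stepStart a b).Nodup := by
  unfold stepStart
  split_ifs <;> simp

variable {G : SimpleGraph V}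

theorem exists_step_walk {a b : V} (h : a = b ∨ G.Adj a b) :
    ∃ p : G.Walk a b, p.edges = stepEdges a b ∧ p.support = stepStart a b ++ [b] := by
  by_cases hab : a = b
  · subst hab
    exact ⟨Walk.nil, by simp [stepEdges], by simp [stepStart]⟩
  · exact ⟨(h.resolve_left hab).toWalk, by simp [stepEdges, hab], by simp [stepStart, hab]⟩

theorem exists_walk_append {a b c : V} {E E' : List (Sym2 V)} {L L' : List V}
    (h : ∃ p : G.Walk a b, p.edges = E ∧ p.support = L ++ [b])
    (h' : ∃ p : G.Walk b c, p.edges = E' ∧ p.support = L' ++ [c]) :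
    ∃ p : G.Walk a c, p.edges = E ++ E' ∧ p.support = (L ++ L') ++ [c] := by
  obtain ⟨p, hp, hp'⟩ := h
  obtain ⟨q, hq, hq'⟩ := h'
  refine ⟨p.append q, by rw [Walk.edges_append, hp, hq], ?_⟩
  rw [Walk.support_append, hp', List.append_assoc, List.append_assoc, ← hq']
  congr 1
  exact q.cons_tail_support

theorem exists_walk_flatMap {a b : ℕ → V} (h : ∀ k, a k = b k ∨ G.Adj (a k) (b k))
    (h' : ∀ k, b k = a (k + 1) ∨ G.Adj (b k) (a (k + 1))) (m : ℕ) :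
    ∃ p : G.Walk (a 0) (a m),
      p.edges = (List.range m).flatMap
        (fun k => stepEdges (a k) (b k) ++ stepEdges (b k) (a (k + 1))) ∧
      p.support = (List.range m).flatMap
        (fun k => stepStart (a k) (b k) ++ stepStart (b k) (a (k + 1))) ++ [a m] := by
  induction m with
  | zero => exact ⟨Walk.nil, by simp, by simp⟩
  | succ m ih =>
    simp only [List.range_succ, List.flatMap_append, List.flatMap_cons, List.flatMap_nil,
      List.append_nil]
    exact exists_walk_append ih
      (exists_walk_append (exists_step_walk (h m)) (exists_step_walk (h' m)))

theorem ofNat_succ_eq {n : ℕ} [NeZero n] (k : ℕ) : Fin.ofNat n (k + 1) = Fin.ofNat n k + 1 := by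
  refine Fin.ext ?_
  simp [Fin.val_add]

theorem map_ofNat_range (n : ℕ) [NeZero n] :
    (List.range n).map (Fin.ofNat n) = List.finRange n := by
  refine List.ext_getElem (by simp) fun i h1 h2 => Fin.ext ?_
  simp only [List.length_finRange] at h2
  simp [Nat.mod_eq_of_lt h2]

/-! ### Transversals of edge holes -/

/-- A choice of an entry vertex `x i` and an exit vertex `y i` in each edge `u i`, such that the
exit vertex of each edge is equal or adjacent to the entry vertex of the next one. -/
structure Transversal (G : SimpleGraph V) {n : ℕ} [NeZero n] (u : Fin n → Sym2 V) where
  x : Fin n → V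
  y : Fin n → V
  x_mem : ∀ i, x i ∈ u i
  y_mem : ∀ i, y i ∈ u i
  step : ∀ i, y i = x (i + 1) ∨ G.Adj (y i) (x (i + 1))

variable {n : ℕ} [NeZero n] {u : Fin n → Sym2 V}

/-- Every edge hole has a transversal which moves from an edge to the next one through a common
vertex whenever there is one. -/
theorem IsEdgeHole.exists_transversal (hu : IsEdgeHole G u) :
    ∃ T : Transversal G u, ∀ i, Meet (u i) (u (i + 1)) → T.y i = T.x (i + 1) := by
  have : ∀ i, ∃ a ∈ u i, ∃ b ∈ u (i + 1), (a = b ∨ G.Adj a b) ∧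
      (Meet (u i) (u (i + 1)) → a = b) := by
    intro i
    by_cases h : Meet (u i) (u (i + 1))
    · obtain ⟨c, hc, hc'⟩ := h
      exact ⟨c, hc, c, hc', Or.inl rfl, fun _ => rfl⟩
    · obtain ⟨a, ha, b, hb, hab⟩ := hu.near i
      exact ⟨a, ha, b, hb, hab, fun h' => absurd h' h⟩
  choose a ha b hb hab hm using this
  refine ⟨⟨fun i => b (i - 1), a, fun i => ?_, ha, fun i => ?_⟩, fun i h => ?_⟩
  · simpa using hb (i - 1)
  · simpa using hab i
  · simpa using hm i h

namespace Transversal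

variable (T : Transversal G u)

theorem x_notMem (hu : IsEdgeHole G u) (i : Fin n) : T.x i ∉ u (i + 1) := by
  obtain ⟨j, rfl⟩ : ∃ j, i = j + 1 := ⟨i - 1, by simp⟩
  exact fun h => hu.far_add_two j ⟨_, T.y_mem j, _, h, T.step j⟩

theorem y_notMem (hu : IsEdgeHole G u) (i : Fin n) : T.y (i + 1) ∉ u i := fun h =>
  hu.far_add_two i ⟨_, h, _, T.x_mem _, T.step _⟩

/-- If `u i` is left and `u (i + 1)` is entered at the same vertex, then both edges are traversed:
otherwise that vertex would link `u i` to `u (i + 2)` or `u (i - 1)` to `u (i + 1)`. -/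
theorem x_ne_y_of_eq (hu : IsEdgeHole G u) {i : Fin n} (h : T.y i = T.x (i + 1)) :
    T.x i ≠ T.y i ∧ T.x (i + 1) ≠ T.y (i + 1) := by
  constructor
  · intro h'
    exact T.x_notMem hu i (h'.trans h ▸ T.x_mem (i + 1))
  · intro h'
    exact T.y_notMem hu i (h.trans h' ▸ T.y_mem i)

/-- The number of edges contributed by `u i` and the step from `u i` to the next edge. -/
noncomputable def localCost (i : Fin n) : ℕ :=
  (stepEdges (T.x i) (T.y i) ++ stepEdges (T.y i) (T.x (i + 1))).length

theorem one_le_localCost (hu : IsEdgeHole G u) (i : Fin n) : 1 ≤ T.localCost i := by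
  unfold localCost
  by_cases h : T.y i = T.x (i + 1)
  · rw [stepEdges_of_ne (T.x_ne_y_of_eq hu h).1]
    simp
  · rw [stepEdges_of_ne h]
    simp

/-- A transversal runs along a cycle, since the vertices it visits are pairwise distinct. -/
theorem exists_cycle (hu : IsEdgeHole G u) :
    ∃ C : G.Walk (T.x 0) (T.x 0), C.IsCycle ∧ C.length = ∑ i, T.localCost i ∧
      C.edges = (List.finRange n).flatMap
        (fun i => stepEdges (T.x i) (T.y i) ++ stepEdges (T.y i) (T.x (i + 1))) ∧
      ∀ v ∈ C.support, ∃ i, v = T.x i ∨ v = T.y i := by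
  obtain ⟨p, hp, hp'⟩ := exists_walk_flatMap (G := G) (a := fun k => T.x (Fin.ofNat n k))
    (b := fun k => T.y (Fin.ofNat n k))
    (fun k => or_iff_not_imp_left.2 fun h => hu.adj (T.x_mem _) (T.y_mem _) h)
    (fun k => by rw [ofNat_succ_eq]; exact T.step _) n
  have h0 : Fin.ofNat n 0 = 0 := rfl
  have hn : Fin.ofNat n n = 0 := Fin.ext (by simp)
  simp only [ofNat_succ_eq] at hp hp'
  obtain ⟨C, hC, hC'⟩ : ∃ C : G.Walk (T.x 0) (T.x 0),
      C.edges = (List.finRange n).flatMap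
        (fun i => stepEdges (T.x i) (T.y i) ++ stepEdges (T.y i) (T.x (i + 1))) ∧
      C.support = (List.finRange n).flatMap
        (fun i => stepStart (T.x i) (T.y i) ++ stepStart (T.y i) (T.x (i + 1))) ++ [T.x 0] := by
    refine ⟨p.copy (by rw [h0]) (by rw [hn]), ?_, ?_⟩
    · rw [Walk.edges_copy, hp, ← map_ofNat_range, List.flatMap_map]
    · rw [Walk.support_copy, hp', ← map_ofNat_range, List.flatMap_map, hn]
  have hlen : C.length = ∑ i, T.localCost i := by
    rw [← Walk.length_edges, hC, List.length_flatMap, ← List.ofFn_eq_map, List.sum_ofFn]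
    rfl
  have hge : n ≤ C.length := by
    rw [hlen]
    calc n = ∑ _i : Fin n, 1 := by simp
      _ ≤ _ := Finset.sum_le_sum fun i _ => T.one_le_localCost hu i
  have h4 := hu.four_le
  -- Vertices of non-consecutive edges differ because these edges are not near. For consecutive
  -- edges the only possible repetition `T.y i = T.x (i + 1)` is skipped by the walk.
  have hnodup : C.support.dropLast.Nodup := by
    rw [hC', List.dropLast_concat, List.nodup_flatMap]
    have hmem : ∀ i v, v ∈ stepStart (T.x i) (T.y i) ++ stepStart (T.y i) (T.x (i + 1)) →
        v ∈ u i ∧ (v = T.x i ∨ v = T.y i ∧ T.y i ≠ T.x (i + 1)) := by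
      intro i v hv
      rw [List.mem_append, mem_stepStart, mem_stepStart] at hv
      rcases hv with ⟨-, rfl⟩ | ⟨h, rfl⟩
      · exact ⟨T.x_mem i, Or.inl rfl⟩
      · exact ⟨T.y_mem i, Or.inr ⟨rfl, h⟩⟩
    have hsucc : ∀ i v, v ∈ stepStart (T.x i) (T.y i) ++ stepStart (T.y i) (T.x (i + 1)) →
        v ∉ stepStart (T.x (i + 1)) (T.y (i + 1)) ++
          stepStart (T.y (i + 1)) (T.x (i + 1 + 1)) := by
      intro i v hv hv'
      obtain ⟨h1, h2⟩ := hmem _ _ hv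
      obtain ⟨h1', h2'⟩ := hmem _ _ hv'
      rcases h2 with rfl | ⟨rfl, h⟩
      · exact T.x_notMem hu i h1'
      · rcases h2' with h' | ⟨h', -⟩
        · exact h h'
        · exact T.y_notMem hu i (h' ▸ h1)
    refine ⟨fun i _ => ?_, (List.nodup_finRange n).imp fun {i j} hij v hv hv' => ?_⟩
    · refine List.Nodup.append (nodup_stepStart _ _) (nodup_stepStart _ _) fun v hv hv' => ?_
      rw [mem_stepStart] at hv hv'
      exact hv.1 (hv.2.symm.trans hv'.2)
    · rcases hu.eq_or_consecutive_of_near ⟨v, (hmem i v hv).1, v, (hmem j v hv').1, Or.inl rfl⟩ with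
        rfl | rfl | rfl
      · exact hij rfl
      · exact hsucc i v hv hv'
      · exact hsucc j v hv' hv
  refine ⟨C, ?_, hlen, hC, ?_⟩
  · rw [Walk.isCycle_iff_isPath_tail_and_le_length]
    refine ⟨Walk.IsPath.mk' ?_, by omega⟩
    rw [Walk.support_tail_of_not_nil]
    · exact C.tail_support_perm_dropLast_support.nodup_iff.2 hnodup
    · rw [Walk.not_nil_iff_lt_length]
      omega
  · intro v hv
    rw [hC', List.mem_append, List.mem_flatMap, List.mem_singleton] at hv
    rcases hv with ⟨i, -, hv⟩ | rfl
    · rw [List.mem_append, mem_stepStart, mem_stepStart] at hv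
      exact ⟨i, hv.imp (fun h => h.2) (fun h => h.2)⟩
    · exact ⟨0, Or.inl rfl⟩

/-! ### Shortest transversals are chordless -/

/-- In a shortest transversal the vertices visited in consecutive edges are adjacent only if they
are consecutive on the cycle: otherwise stepping directly between them gives a shorter one. -/
theorem mem_edges_of_minimal (hu : IsEdgeHole G u)
    (hT : ∀ T' : Transversal G u, ∑ i, T.localCost i ≤ ∑ i, T'.localCost i) {i : Fin n} {p r : V}
    (hp : p = T.x i ∨ p = T.y i) (hr : r = T.x (i + 1) ∨ r = T.y (i + 1)) (hpr : G.Adj p r) :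
    (p = T.y i ∧ r = T.x (i + 1)) ∨ (p = T.x i ∧ r = T.y i) ∨
      (p = T.x (i + 1) ∧ r = T.y (i + 1)) := by
  by_contra hcon
  simp only [not_or] at hcon
  obtain ⟨h1, h2, h3⟩ := hcon
  have hpu : p ∈ u i := by rcases hp with rfl | rfl; exacts [T.x_mem i, T.y_mem i]
  have hru : r ∈ u (i + 1) := by rcases hr with rfl | rfl; exacts [T.x_mem _, T.y_mem _]
  have hii := (add_one_ne hu.four_le i).1
  have hinj : ∀ j, j + 1 = i + 1 → j = i := fun j => add_right_cancel
  let T' : Transversal G u :=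
    { x := Function.update T.x (i + 1) r
      y := Function.update T.y i p
      x_mem := by
        intro j
        by_cases hj : j = i + 1
        · subst hj
          simpa using hru
        · simpa [hj] using T.x_mem j
      y_mem := by
        intro j
        by_cases hj : j = i
        · subst hj
          simpa using hpu
        · simpa [hj] using T.y_mem j
      step := by
        intro j
        by_cases hj : j = i
        · subst hj
          simpa using Or.inr hpr
        · have hj' : j + 1 ≠ i + 1 := fun h => hj (hinj j h)
          simpa [hj, hj'] using T.step j }
  have hx : T'.x (i + 1) = r := Function.update_self ..
  have hy : T'.y i = p := Function.update_self ..
  have hx' : ∀ j, j ≠ i + 1 → T'.x j = T.x j := fun j hj => Function.update_of_ne hj ..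
  have hy' : ∀ j, j ≠ i → T'.y j = T.y j := fun j hj => Function.update_of_ne hj ..
  have hother : ∀ j, j ≠ i → j ≠ i + 1 → T'.localCost j = T.localCost j := by
    intro j hj hj'
    unfold localCost
    rw [hx' j hj', hy' j hj, hx' (j + 1) fun h => hj (hinj j h)]
  have hi : T'.localCost i = (stepEdges (T.x i) p).length + 1 := by
    unfold localCost
    rw [hx, hy, hx' i hii.symm, stepEdges_of_ne hpr.ne, List.length_append, List.length_singleton]
  have hi' : T'.localCost (i + 1) = (stepEdges r (T.y (i + 1))).length +
      (stepEdges (T.y (i + 1)) (T.x (i + 1 + 1))).length := by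
    unfold localCost
    rw [hx, hy' _ hii, hx' (i + 1 + 1) (add_one_ne hu.four_le (i + 1)).1, List.length_append]
  have hTi : T.localCost i = (stepEdges (T.x i) (T.y i)).length +
    (stepEdges (T.y i) (T.x (i + 1))).length := List.length_append
  have hTi' : T.localCost (i + 1) = (stepEdges (T.x (i + 1)) (T.y (i + 1))).length +
    (stepEdges (T.y (i + 1)) (T.x (i + 1 + 1))).length := List.length_append
  have hle : T'.localCost i ≤ T.localCost i ∧ T'.localCost (i + 1) ≤ T.localCost (i + 1) ∧
      (T'.localCost i < T.localCost i ∨ T'.localCost (i + 1) < T.localCost (i + 1)) := by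
    rw [hi, hi', hTi, hTi']
    -- A new step from `T.y i` skips the edge `u (i + 1)`, one to `T.x (i + 1)` skips the edge `u i`,
    -- and a step from `T.x i` to `T.y (i + 1)` skips both.
    by_cases hpy : p = T.y i
    · have hrx : r ≠ T.x (i + 1) := fun h => h1 ⟨hpy, h⟩
      have hry : r = T.y (i + 1) := hr.resolve_left hrx
      have hyx : T.y i ≠ T.x (i + 1) := fun h => h3 ⟨hpy.trans h, hry⟩
      rw [stepEdges_of_ne hyx, stepEdges_of_eq hry,
        stepEdges_of_ne fun h : T.x (i + 1) = T.y (i + 1) => hrx (hry.trans h.symm), hpy]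
      simp
    · have hpx : p = T.x i := hp.resolve_right hpy
      rw [stepEdges_of_eq hpx.symm, stepEdges_of_ne (hpx ▸ hpy)]
      by_cases hrx : r = T.x (i + 1)
      · have hyx : T.y i ≠ T.x (i + 1) := fun h => h2 ⟨hpx, hrx.trans h.symm⟩
        rw [stepEdges_of_ne hyx, hrx]
        simp
      · have hry : r = T.y (i + 1) := hr.resolve_left hrx
        rw [stepEdges_of_eq hry,
          stepEdges_of_ne fun h : T.x (i + 1) = T.y (i + 1) => hrx (hry.trans h.symm)]
        simp
  refine absurd (hT T') (not_le.2 (Finset.sum_lt_sum (fun j _ => ?_) ?_))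
  · by_cases hj : j = i
    · exact hj ▸ hle.1
    by_cases hj' : j = i + 1
    · exact hj' ▸ hle.2.1
    · exact (hother j hj hj').le
  · rcases hle.2.2 with h | h
    · exact ⟨i, Finset.mem_univ _, h⟩
    · exact ⟨i + 1, Finset.mem_univ _, h⟩

end Transversal

theorem IsEdgeHole.exists_cycleGraph (hu : IsEdgeHole G u) :
    ∃ l : ℕ, n ≤ l ∧ (cycleGraph l).IsIndContained G := by
  obtain ⟨T₀, -⟩ := hu.exists_transversal
  have : Nonempty (Transversal G u) := ⟨T₀⟩
  let T : Transversal G u := Function.argmin fun T => ∑ i, T.localCost i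
  have hT : ∀ T' : Transversal G u, ∑ i, T.localCost i ≤ ∑ i, T'.localCost i :=
    fun T' => Function.argmin_le (fun T : Transversal G u => ∑ i, T.localCost i) T'
  obtain ⟨C, hC, hlen, hedges, hsupp⟩ := T.exists_cycle hu
  refine ⟨C.length, ?_, cycleGraph_isIndContained hC ?_⟩
  · rw [hlen]
    calc n = ∑ _i : Fin n, 1 := by simp
      _ ≤ _ := Finset.sum_le_sum fun i _ => T.one_le_localCost hu i
  have hxy : ∀ i, T.x i ≠ T.y i → s(T.x i, T.y i) ∈ C.edges := fun i h => by
    rw [hedges, List.mem_flatMap]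
    exact ⟨i, List.mem_finRange i, List.mem_append_left _ (mem_stepEdges h)⟩
  have hyx : ∀ i, T.y i ≠ T.x (i + 1) → s(T.y i, T.x (i + 1)) ∈ C.edges := fun i h => by
    rw [hedges, List.mem_flatMap]
    exact ⟨i, List.mem_finRange i, List.mem_append_right _ (mem_stepEdges h)⟩
  have hsucc : ∀ i p r, (p = T.x i ∨ p = T.y i) → (r = T.x (i + 1) ∨ r = T.y (i + 1)) →
      G.Adj p r → s(p, r) ∈ C.edges := by
    intro i p r hp hr hpr
    rcases T.mem_edges_of_minimal hu hT hp hr hpr with ⟨rfl, rfl⟩ | ⟨rfl, rfl⟩ | ⟨rfl, rfl⟩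
    exacts [hyx i hpr.ne, hxy i hpr.ne, hxy (i + 1) hpr.ne]
  intro p hp r hr hpr
  obtain ⟨i, hi⟩ := hsupp p hp
  obtain ⟨j, hj⟩ := hsupp r hr
  have hpu : p ∈ u i := by rcases hi with rfl | rfl; exacts [T.x_mem i, T.y_mem i]
  have hru : r ∈ u j := by rcases hj with rfl | rfl; exacts [T.x_mem j, T.y_mem j]
  rcases hu.eq_or_consecutive_of_near ⟨p, hpu, r, hru, Or.inr hpr⟩ with
    rfl | rfl | rfl
  · rcases hi with rfl | rfl <;> rcases hj with rfl | rfl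
    · exact absurd rfl hpr.ne
    · exact hxy _ hpr.ne
    · rw [Sym2.eq_swap]
      exact hxy _ hpr.ne.symm
    · exact absurd rfl hpr.ne
  · exact hsucc i p r hi hj hpr
  · rw [Sym2.eq_swap]
    exact hsucc j r p hj hi hpr.symm

/-! ### Regrouping cyclic sequences -/

theorem flatMap_filter_eq {α β : Type*} (p : α → Prop) [DecidablePred p] (h : α → List β)
    (l : List α) : (l.filter p).flatMap h = l.flatMap fun a => if p a then h a else [] := by
  induction l with
  | nil => rfl
  | cons a l ih =>
    by_cases ha : p a <;> simp [ha, ih]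

/-- If no two consecutive indices satisfy `M`, the contribution of each index satisfying `M` can be
merged into that of its successor. -/
theorem flatMap_regroup {α : Type*} {n : ℕ} [NeZero n] (M : Fin n → Prop) [DecidablePred M]
    (h0 : ¬ M (0 - 1)) (hM : ∀ i, M i → ¬ M (i + 1)) (f g : Fin n → List α)
    (hg : ∀ i, M i → g i = []) :
    (List.finRange n).flatMap (fun i => f i ++ g i) =
      ((List.finRange n).filter fun i => ¬ M i).flatMap
        fun i => ((if M (i - 1) then f (i - 1) else []) ++ f i) ++ g i := by
  rw [flatMap_filter_eq, ← map_ofNat_range, List.flatMap_map, List.flatMap_map]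
  have key : ∀ m : ℕ, (List.range m).flatMap (fun k => f (Fin.ofNat n k) ++ g (Fin.ofNat n k)) =
      (List.range m).flatMap (fun k => if ¬ M (Fin.ofNat n k) then
        ((if M (Fin.ofNat n k - 1) then f (Fin.ofNat n k - 1) else []) ++ f (Fin.ofNat n k)) ++
          g (Fin.ofNat n k) else []) ++
        if M (Fin.ofNat n m - 1) then f (Fin.ofNat n m - 1) else [] := by
    intro m
    induction m with
    | zero => exact (if_neg h0).symm
    | succ m ih =>
      simp only [List.range_succ, List.flatMap_append, List.flatMap_cons, List.flatMap_nil,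
        List.append_nil, ofNat_succ_eq, add_sub_cancel_right]
      rw [ih]
      generalize Fin.ofNat n m = i
      by_cases h : M i
      · have h' : ¬ M (i - 1) := fun h' => hM _ h' (by simpa using h)
        simp [h, h', hg _ h]
      · simp [h]
  have hn : Fin.ofNat n n = 0 := Fin.ext (by simp)
  have := key n
  rwa [hn, if_neg h0, List.append_nil] at this

/-- If the cyclic successor of a member of an increasing enumeration is also a member, then it is the
next one, cyclically. -/
theorem add_one_eq_of_strictMono {n q : ℕ} [NeZero n] [NeZero q] (hn : 2 ≤ n) (hq : 2 ≤ q)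
    {t : Fin q → Fin n} (ht : StrictMono t) {k l : Fin q} (h : t k = t l + 1) : k = l + 1 := by
  have hv := congrArg Fin.val h
  rw [val_add_one hn] at hv
  refine Fin.ext ?_
  rw [val_add_one hq]
  have hl := (t l).2
  have hk := k.2
  split_ifs at hv with h1
  · have hk0 : k.val = 0 := by
      by_contra hk0
      have : t 0 < t k := ht (Fin.pos_iff_ne_zero.2 fun h => hk0 (by simp [h]))
      rw [Fin.lt_def] at this
      omega
    have hl0 : l.val + 1 = q := by
      by_contra hl0
      have : t l < t ⟨l.val + 1, by omega⟩ := ht (Fin.lt_def.2 (Nat.lt_succ_self _))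
      rw [Fin.lt_def] at this
      omega
    rw [if_pos hl0, hk0]
  · have hlk : l < k := ht.lt_iff_lt.1 (Fin.lt_def.2 (by omega))
    rw [Fin.lt_def] at hlk
    have hle : k.val ≤ l.val + 1 := by
      by_contra hlt
      have h2 : t l < t ⟨l.val + 1, by omega⟩ := ht (Fin.lt_def.2 (Nat.lt_succ_self _))
      have h3 : t ⟨l.val + 1, by omega⟩ < t k := ht (Fin.lt_def.2 (by simp only; omega))
      rw [Fin.lt_def] at h2 h3
      omega
    rw [if_neg (by omega)]
    omega

/-! ### Edge holes yield fertile sprouts -/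

/-- Otherwise `u (i + 1)` would join `u i` and `u (i + 2)`. -/
theorem IsEdgeHole.not_meet_succ (hu : IsEdgeHole G u) {i : Fin n} (h : Meet (u i) (u (i + 1))) :
    ¬ Meet (u (i + 1)) (u (i + 1 + 1)) := fun h' =>
  hu.far_add_two i (near_of_meet (hu.mem (i + 1)) h h')

theorem IsEdgeHole.rotate (hu : IsEdgeHole G u) (c : Fin n) :
    IsEdgeHole G fun i => u (i + c) := by
  refine ⟨hu.four_le, fun i => hu.mem _, fun i => ?_, fun i j h h1 h2 => ?_⟩
  · rw [add_right_comm]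
    exact hu.near _
  · refine hu.far _ _ (fun h' => h (add_right_cancel h')) (fun h' => h1 ?_) (fun h' => h2 ?_)
    · rw [add_right_comm] at h'
      exact add_right_cancel h'
    · rw [add_right_comm] at h'
      exact add_right_cancel h'

/-- The numbering of an edge hole can be chosen such that its last and first edge are disjoint. -/
theorem IsEdgeHole.exists_rotate (hu : IsEdgeHole G u) :
    ∃ u' : Fin n → Sym2 V, IsEdgeHole G u' ∧ ¬ Meet (u' (0 - 1)) (u' 0) := by
  obtain ⟨i, hi⟩ : ∃ i, ¬ Meet (u i) (u (i + 1)) := by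
    by_contra hcon
    push Not at hcon
    exact hu.not_meet_succ (hcon 0) (hcon _)
  exact ⟨_, hu.rotate (i + 1), by simpa [add_comm i] using hi⟩

theorem Transversal.stepEdges_eq (T : Transversal G u) (i : Fin n) (h : T.x i ≠ T.y i) :
    stepEdges (T.x i) (T.y i) = [u i] := by
  rw [stepEdges_of_ne h, (Sym2.mem_and_mem_iff h).1 ⟨T.x_mem i, T.y_mem i⟩]

open Classical in
/-- The cycle along a transversal that uses common vertices of consecutive edges turns an edge hole
into a fertile sprout: the `w`-edges are the steps between disjoint consecutive edges. -/
theorem IsEdgeHole.exists_fertile_sprout (hu : IsEdgeHole G u)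
    (hlast : ¬ Meet (u (0 - 1)) (u 0)) : ∃ P : Sprout G n, P.IsFertile := by
  have h4 := hu.four_le
  obtain ⟨T, hT⟩ := hu.exists_transversal
  obtain ⟨C, hC, -, hedges, -⟩ := T.exists_cycle hu
  let M : Fin n → Prop := fun i => T.y i = T.x (i + 1)
  have hmeet : ∀ i, M i → Meet (u i) (u (i + 1)) := fun i (h : T.y i = T.x (i + 1)) =>
    ⟨_, T.y_mem i, h ▸ T.x_mem (i + 1)⟩
  have hnmeet : ∀ i, ¬ M i → ¬ Meet (u i) (u (i + 1)) := fun i h h' => h (hT i h')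
  have hM0 : ¬ M (0 - 1) := fun h => hlast (by simpa using hmeet _ h)
  have hM : ∀ i, M i → ¬ M (i + 1) := fun i h h' => hu.not_meet_succ (hmeet _ h) (hmeet _ h')
  let L : List (Fin n) := (List.finRange n).filter fun i => ¬ M i
  have hL : ∀ i, i ∈ L ↔ ¬ M i := fun i => by simp [L]
  have hnodup : L.Nodup := (List.nodup_finRange n).filter _
  let t : Fin L.length → Fin n := L.get
  have ht : ∀ k, ¬ M (t k) := fun k => (hL _).1 (L.get_mem k)
  have hmono : StrictMono t := by
    have h : L.Pairwise (· < ·) := (List.pairwise_lt_finRange n).filter _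
    exact fun i j hij => List.pairwise_iff_get.1 h i j hij
  have hofFn : ∀ {α : Type _} (h : Fin n → α), List.ofFn (fun k => h (t k)) = L.map h := by
    intro α h
    conv_rhs => rw [← List.ofFn_get L, List.map_ofFn]
    rfl
  -- By `hM`, the successor map sends the indices satisfying `M` injectively to the others.
  have hq : n ≤ 2 * L.length := by
    have hcard : L.length = (Finset.univ.filter fun i => ¬ M i).card := by
      rw [← List.toFinset_card_of_nodup hnodup]
      congr 1
      ext i
      simp [hL]
    have hle : (Finset.univ.filter M).card ≤ (Finset.univ.filter fun i => ¬ M i).card := by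
      refine Finset.card_le_card_of_injOn (· + 1) (fun i hi => ?_)
        fun i _ j _ h => add_right_cancel h
      simp only [Finset.coe_filter, Finset.mem_univ, true_and, Set.mem_ofPred_eq] at hi ⊢
      exact hM i hi
    have hsum := Finset.card_filter_add_card_filter_not (s := (Finset.univ : Finset (Fin n))) M
    rw [Finset.card_univ, Fintype.card_fin] at hsum
    omega
  have : NeZero L.length := ⟨by omega⟩
  let f : Fin n → List (Sym2 V) := fun i => stepEdges (T.x i) (T.y i)
  -- The stretch of the sprout that ends with the `w`-edge at `i` consists of `u i` and, if `u (i - 1)`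
  -- meets `u i`, of `u (i - 1)`; an edge entered and left at the same vertex is pending.
  let gapAt : Fin n → List (Sym2 V) := fun i => (if M (i - 1) then f (i - 1) else []) ++ f i
  let petalsAt : Fin n → List (Sym2 V) := fun i => (if M (i - 1) then [u (i - 1)] else []) ++ [u i]
  let wAt : Fin n → Sym2 V := fun i => s(T.y i, T.x (i + 1))
  have hwmem : ∀ i, ¬ M i → wAt i ∈ G.edgeSet := fun i h => (T.step i).resolve_left h
  -- No edge of the hole contains both ends of a `w`-edge.
  have hw_notMem : ∀ i j, ¬ M i → T.y i ∈ u j → T.x (i + 1) ∈ u j → False := by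
    intro i j hi hy hx
    rcases hu.eq_or_consecutive_of_near ⟨_, T.y_mem i, _, hy, Or.inl rfl⟩ with rfl | rfl | rfl
    · exact hnmeet _ hi ⟨_, hx, T.x_mem _⟩
    · exact hnmeet _ hi ⟨_, T.y_mem _, hy⟩
    · exact hu.far_add_two j ⟨_, hx, _, T.x_mem _, Or.inl rfl⟩
  have hy_inj : ∀ i j, T.y i = T.y j → i = j := by
    intro i j h
    rcases hu.eq_or_consecutive_of_near ⟨_, T.y_mem i, _, T.y_mem j, Or.inl h⟩ with
      rfl | rfl | rfl
    · rfl
    · exact absurd (h ▸ T.y_mem i) (T.y_notMem hu i)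
    · exact absurd (h ▸ T.y_mem j) (T.y_notMem hu j)
  have hw_inj : ∀ i j, wAt i = wAt j → i = j := by
    intro i j h
    rcases Sym2.eq_iff.1 h with ⟨h, -⟩ | ⟨h, h'⟩
    · exact hy_inj i j h
    rcases hu.eq_or_consecutive_of_near ⟨_, T.y_mem i, _, T.x_mem (j + 1), Or.inl h⟩ with
      rfl | h'' | rfl
    · exact absurd ⟨_, T.y_mem j, _, T.x_mem _, Or.inl h'.symm⟩ (hu.far_add_two j)
    · exact (add_right_cancel h'').symm
    · exact absurd (h ▸ T.x_mem (j + 1)) (T.y_notMem hu (j + 1))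
  have hgap_nil : ∀ i, gapAt i = [] → T.x i = T.y i ∧ ¬ M (i - 1) := by
    intro i hi
    obtain ⟨h1, h2⟩ := List.append_eq_nil_iff.1 hi
    have hxy : T.x i = T.y i := by
      by_contra h
      simp [f, T.stepEdges_eq i h] at h2
    refine ⟨hxy, fun h => ?_⟩
    have h' : T.y (i - 1) = T.x (i - 1 + 1) := h
    have := (T.x_ne_y_of_eq hu h').2
    rw [sub_add_cancel] at this
    exact this hxy
  have hpetals : ∀ i, gapAt i = [] → petalsAt i = [u i] := fun i hi => by
    simp [petalsAt, (hgap_nil i hi).2]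
  have hC' : C.edges = (List.ofFn fun k => gapAt (t k) ++ [wAt (t k)]).flatten := by
    rw [hedges, flatMap_regroup M hM0 hM _ _ fun i h => stepEdges_of_eq h,
      hofFn fun i => gapAt i ++ [wAt i], ← List.flatMap_def]
    refine List.flatMap_congr fun i hi => ?_
    rw [stepEdges_of_ne ((hL i).1 hi)]
  have hu' : List.ofFn u = (List.ofFn fun k => petalsAt (t k)).flatten := by
    have := flatMap_regroup M hM0 hM (fun i => [u i]) (fun _ => []) fun _ _ => rfl
    simp only [List.append_nil] at this
    rw [hofFn petalsAt, ← List.flatMap_def, List.ofFn_eq_map, List.map_eq_flatMap]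
    exact this
  refine ⟨{
    q := L.length
    le_q := by omega
    q_le := (List.length_filter_le _ _).trans (List.length_finRange).le
    u := u
    w := fun k => wAt (t k)
    u_mem := hu.mem
    w_mem := fun k => hwmem _ (ht k)
    u_injective := hu.injective
    w_injective := fun k l h => hmono.injective (hw_inj _ _ h)
    u_ne_w := fun j k h => hw_notMem (t k) j (ht k) (h ▸ Sym2.mem_mk_left _ _)
      (h ▸ Sym2.mem_mk_right _ _)
    base := T.x 0
    C := C
    isCycle := hC
    gap := fun k => gapAt (t k)
    edges_eq := hC'
    petals := fun k => petalsAt (t k)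
    u_eq := hu'
    u_disjoint := ?_
    pending := ?_
    connecting := ?_
    pending_disjoint := ?_ }, ?_⟩
  · rintro i j ⟨h, h1, h2⟩ h'
    rw [finRotate_apply] at h1 h2
    exact hu.far i j h.symm h1 h2 (h'.near G)
  · intro k hk
    obtain ⟨hxy, hpred⟩ := hgap_nil _ hk
    obtain ⟨l, hl⟩ : ∃ l, t l = t k - 1 := List.mem_iff_get.1 ((hL _).2 hpred)
    have hkl : k = l + 1 := add_one_eq_of_strictMono (by omega) (by omega) hmono (by simp [hl])
    have hlk : t k = t l + 1 := by simp [hl]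
    rw [finRotate_symm_apply]
    have hkl' : k - 1 = l := by simp [hkl]
    rw [hkl']
    simp only [wAt]
    refine ⟨u (t k), hpetals _ hk, ⟨T.x (t k), ?_, ?_, T.x_mem _⟩, ?_⟩
    · rw [hlk]
      exact Sym2.mem_mk_right _ _
    · rw [hxy]
      exact Sym2.mem_mk_left _ _
    · rintro j ⟨z, hz, hz', hzj⟩
      congr 1
      have hz1 : z = T.y (t k) := by
        rcases Sym2.mem_iff.1 hz' with h | rfl
        · exact h
        · exfalso
          rcases Sym2.mem_iff.1 hz with h | h
          · rw [hlk] at h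
            exact hu.far_add_two (t l) ⟨_, T.y_mem _, _, T.x_mem _, Or.inl h.symm⟩
          · rw [← hlk] at h
            exact T.x_notMem hu (t k) (h ▸ T.x_mem _)
      rcases hu.eq_or_consecutive_of_near ⟨z, hz1 ▸ T.y_mem (t k), z, hzj, Or.inl rfl⟩ with
        h | h | h
      · exact h
      · rw [hz1, ← hxy, h] at hzj
        exact absurd hzj (T.x_notMem hu _)
      · rw [hz1, h] at hzj
        exact absurd hzj (T.y_notMem hu j)
  · intro k hk
    simp only [petalsAt, gapAt, f]
    by_cases h : M (t k - 1)
    · have h' : T.y (t k - 1) = T.x (t k - 1 + 1) := h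
      obtain ⟨h1, h2⟩ := T.x_ne_y_of_eq hu h'
      rw [sub_add_cancel] at h2
      simp [h, T.stepEdges_eq _ h1, T.stepEdges_eq _ h2]
    · have h2 : T.x (t k) ≠ T.y (t k) := fun h2 => hk (by simp [gapAt, f, h, stepEdges_of_eq h2])
      simp [h, T.stepEdges_eq _ h2]
  · intro k l hkl hk hl p hp p' hp' hpp'
    simp only [hpetals _ hk, hpetals _ hl, List.mem_singleton] at hp hp'
    subst hp hp'
    rcases hu.eq_or_consecutive_of_near (hpp'.near G) with h | h | h
    · exact hkl (hmono.injective h.symm)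
    · exact hnmeet _ (ht k) (h ▸ hpp')
    · exact hnmeet _ (ht l) (h ▸ hpp'.symm)
  · rintro i j ⟨h, h1, h2⟩ a ha b hb hab
    rw [finRotate_apply] at h1 h2
    exact hu.far i j h.symm h1 h2 ⟨a, ha, b, hb, Or.inr hab⟩

theorem IsEdgeHole.containsFertileSprout (hu : IsEdgeHole G u) : ContainsFertileSprout G n := by
  obtain ⟨u', hu', hlast⟩ := (hu.map (induceUnivIso G).symm.toEmbedding).exists_rotate
  exact ⟨Set.univ, hu'.exists_fertile_sprout hlast⟩

end ChordalLineSquare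

theorem mainTheorem2 {V : Type*} (G : SimpleGraph V) :
    ChordalLineSquare.IsChordal (ChordalLineSquare.power G.lineGraph 2) ↔
      (∀ l : ℕ, 6 ≤ l → ¬ (SimpleGraph.cycleGraph l).IsIndContained G) ∧
      ¬ ChordalLineSquare.ContainsFertileSprout G 4 ∧
      ¬ ChordalLineSquare.ContainsFertileSprout G 5 := by
  open ChordalLineSquare in
  rw [isChordal_power_lineGraph_iff]
  constructor
  · intro h
    refine ⟨fun l hl hc => ?_, fun hs => ?_, fun hs => ?_⟩
    · obtain ⟨n, _, u, hu⟩ := exists_isEdgeHole_of_cycleGraph hl hc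
      exact h n u hu
    · obtain ⟨_, u, hu⟩ := exists_isEdgeHole_of_fertileSprout le_rfl hs
      exact h 4 u hu
    · obtain ⟨_, u, hu⟩ := exists_isEdgeHole_of_fertileSprout (by omega) hs
      exact h 5 u hu
  · rintro ⟨hc, h4, h5⟩ n _ u hu
    rcases lt_or_ge n 6 with hn | hn
    · have := hu.four_le
      obtain rfl | rfl : n = 4 ∨ n = 5 := by omega
      · exact h4 hu.containsFertileSprout
      · exact h5 hu.containsFertileSprout
    · obtain ⟨l, hl, hl'⟩ := hu.exists_cycleGraph
      exact hc l (hn.trans hl) hl'
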